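/- Let $G$ be a finitely generated torsion-free nilpotent group, let $H$ be a subgroup of $G$ of finite index $m > 1$, and let $f : H \to G$ be a group homomorphism. The $f$-core of $H$ is the largest subgroup $K \le H$ which is normal in $G$ and $f$-invariant, i.e. $f(K) \le K$. Suppose that $f$ is simple, i.e. that the $f$-core of $H$ is the trivial subgroup. Then the derived length $s(G)$ of $G$, i.e. the least $n \ge 0$ such that the $n$-th term $G^{(n)}$ of the derived series ($G^{(0)} = G$, $G^{(i+1)} = [G^{(i)}, G^{(i)}]$) is trivial, satisfies $$s(G) \le l(m),$$ where $l(m)$ is the number of prime factors of $m$ counted with multiplicity. -/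

import Mathlib

/-- A virtual endomorphism of `G` is a homomorphism `f : H →* G` from a subgroup `H` of `G`.
A subgroup `K` of `G` is `f`-invariant if `K ≤ H` and `f` maps `K` into `K`. -/
def IsFInvariant {G : Type*} [Group G] {H : Subgroup G} (f : H →* G) (K : Subgroup G) : Prop :=
  K ≤ H ∧ (K.subgroupOf H).map f ≤ K

/-- The `f`-core of `H`: the subgroup generated by all `f`-invariant subgroups of `H` that are
normal in `G`. It is itself one of them (see `fCore_isGreatest`), hence the largest one. -/
def fCore {G : Type*} [Group G] {H : Subgroup G} (f : H →* G) : Subgroup G :=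
  sSup {K : Subgroup G | K.Normal ∧ IsFInvariant f K}

/-- The `f`-core is the largest subgroup of `H` that is normal in `G` and `f`-invariant. -/
theorem fCore_isGreatest {G : Type*} [Group G] {H : Subgroup G} (f : H →* G) :
    IsGreatest {K : Subgroup G | K.Normal ∧ IsFInvariant f K} (fCore f) := by
  refine ⟨⟨?_, ?_, ?_⟩, fun K hK => le_sSup hK⟩
  · exact Subgroup.sSup_normal _ (fun K hK => hK.1)
  · exact sSup_le fun K hK => hK.2.1
  · rw [Subgroup.map_le_iff_le_comap]
    have key : fCore f ≤ ((fCore f).comap f).map H.subtype := by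
      refine sSup_le fun K hK x hx => ?_
      refine ⟨⟨x, hK.2.1 hx⟩, ?_, rfl⟩
      exact le_sSup (a := K) hK (hK.2.2 ⟨⟨x, hK.2.1 hx⟩, hx, rfl⟩)
    intro x hx
    obtain ⟨y, hy, hyx⟩ := key hx
    rwa [← Subtype.ext hyx]

/-- `f : H →* G` is simple if its `f`-core is trivial. -/
def IsSimpleVirtualEnd {G : Type*} [Group G] {H : Subgroup G} (f : H →* G) : Prop :=
  fCore f = ⊥

/-- The derived length of `G`: the least `n` such that the `n`-th term of the derived series
is trivial, and `⊤` if there is none. -/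
noncomputable def groupDerivedLength (G : Type*) [Group G] : ℕ∞ :=
  ⨅ (n : ℕ) (_ : derivedSeries G n = ⊥), (n : ℕ∞)

/-!
Let `D` be the largest `f`-invariant subgroup of `H`, normal in `G` or not (`invariantCore`). The
theorem follows from a statement that needs no simplicity: if `H` and `f(H)` have finite index in a
torsion-free nilpotent group `G`, then every element of the `Ω(m)`-th derived subgroup has a
positive power in `D` (`exists_pow_mem_invariantCore`).

This is proved by induction along the quotients by the center `Z`. Centralizers in `G` are isolated
(`commute_of_commute_pow`), so anything commuting with `f(H)` is central; hence `f` maps `H ⊓ Z`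
into `Z` and induces a virtual endomorphism of `G / Z`, which is torsion-free. Let `E` be the
preimage in `G` of its invariant core.
* If `Z ≤ H`, then the index of the domain is unchanged, and `E ≤ H` is `f`-invariant, so `E ≤ D`.
* Otherwise the index of the domain loses at least one prime factor
  (`cardFactors_index_map_center_lt`). Since
  `E = (E ⊓ H) Z` with `Z` central, `[E, E] = [E ⊓ H, E ⊓ H]` is `f`-invariant
  (`isFInvariant_commutator`), so `[E, E] ≤ D`. If all elements of a subgroup `T` have powers in `E`
  then those of `[T, T]` have powers in `[E, E]` (`exists_pow_mem_commutator`), so one further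
  derived subgroup suffices.

For simple `f`, the map `f` is injective (`IsSimpleVirtualEnd.injective`), and `f(H)` has finite
index because a finitely generated nilpotent group has a rank function on its subgroups which drops
at infinite index (`HasRankFunction.index_range_ne_zero`): otherwise the iterated images of `G`
would descend forever. The subgroup `D ⊓ Z` is `f`-invariant and normal, so it is trivial, and by
torsion-freeness the `Ω(m)`-th derived subgroup meets `Z` trivially. A normal subgroup of a
nilpotent group with this property is trivial.
-/

open scoped commutatorElement

/-! ### Commutators with central values -/

theorem commutatorElement_pow_left_of_mem_center {G : Type*} [Group G] {x y : G}
    (h : ⁅x, y⁆ ∈ Subgroup.center G) (n : ℕ) : ⁅x ^ n, y⁆ = ⁅x, y⁆ ^ n := by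
  induction n with
  | zero => simp
  | succ n ih =>
    have hc : x ^ n * ⁅x, y⁆ = ⁅x, y⁆ * x ^ n := Subgroup.mem_center_iff.mp h _
    rw [pow_succ, commutatorElement_mul_left_eq_conj_mul, hc,
      mul_inv_cancel_right, ih, pow_succ']

theorem commutatorElement_pow_right_of_mem_center {G : Type*} [Group G] {x y : G}
    (h : ⁅x, y⁆ ∈ Subgroup.center G) (n : ℕ) : ⁅x, y ^ n⁆ = ⁅x, y⁆ ^ n := by
  have h' : ⁅y, x⁆ ∈ Subgroup.center G := by
    rw [← commutatorElement_inv]; exact inv_mem h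
  rw [← commutatorElement_inv, commutatorElement_pow_left_of_mem_center h', ← inv_pow,
    commutatorElement_inv]

/-- Central factors do not affect commutators. -/
theorem commutatorElement_mul_mul_of_mem_center {G : Type*} [Group G] {a b z w : G}
    (hz : z ∈ Subgroup.center G) (hw : w ∈ Subgroup.center G) : ⁅a * z, b * w⁆ = ⁅a, b⁆ := by
  have h1 : ∀ g : G, ⁅z, g⁆ = 1 := fun g =>
    commutatorElement_eq_one_iff_mul_comm.mpr (Subgroup.mem_center_iff.mp hz g).symm
  have h2 : ∀ g : G, ⁅g, w⁆ = 1 := fun g =>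
    commutatorElement_eq_one_iff_mul_comm.mpr (Subgroup.mem_center_iff.mp hw g)
  rw [commutatorElement_mul_left_eq_conj_mul, h1, mul_one, mul_inv_cancel, one_mul,
    commutatorElement_mul_right_eq_mul_conj, h2, mul_one, mul_inv_cancel_right]

/-! ### Isolated centralizers in torsion-free nilpotent groups -/

theorem eq_one_of_pow_eq_one {G : Type*} [Group G] (htf : ∀ g : G, IsOfFinOrder g → g = 1)
    {g : G} {n : ℕ} (hn : 0 < n) (h : g ^ n = 1) : g = 1 :=
  htf g (isOfFinOrder_iff_pow_eq_one.mpr ⟨n, hn, h⟩)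

/-- The successive quotients of the upper central series of a torsion-free group are
torsion-free. -/
theorem mem_upperCentralSeries_of_pow_mem {G : Type*} [Group G]
    (htf : ∀ g : G, IsOfFinOrder g → g = 1) {n : ℕ} (hn : 0 < n) (i : ℕ) :
    ∀ x ∈ Subgroup.upperCentralSeries G (i + 1), x ^ n ∈ Subgroup.upperCentralSeries G i →
      x ∈ Subgroup.upperCentralSeries G i := by
  induction i with
  | zero =>
    intro x _ hx
    rw [Subgroup.upperCentralSeries_zero, Subgroup.mem_bot] at hx ⊢
    exact eq_one_of_pow_eq_one htf hn hx
  | succ i ih =>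
    intro x hx hxn
    rw [Subgroup.mem_upperCentralSeries_succ_iff]
    intro g
    have hc : ⁅x, g⁆ ∈ Subgroup.upperCentralSeries G (i + 1) :=
      Subgroup.mem_upperCentralSeries_succ_iff.mp hx g
    refine ih ⁅x, g⁆ hc ?_
    -- Modulo the `i`-th term, `⁅x, g⁆` is central, so `⁅x, g⁆ ^ n` becomes `⁅x ^ n, g⁆ = 1`.
    let q := QuotientGroup.mk' (Subgroup.upperCentralSeries G i)
    have hcen : ⁅q x, q g⁆ ∈ Subgroup.center (G ⧸ Subgroup.upperCentralSeries G i) := by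
      rw [Subgroup.mem_center_iff]
      intro y
      obtain ⟨y, rfl⟩ := QuotientGroup.mk'_surjective _ y
      have := Subgroup.mem_upperCentralSeries_succ_iff.mp hc y
      rw [← map_commutatorElement]
      refine (commutatorElement_eq_one_iff_mul_comm.mp ?_).symm
      rw [← map_commutatorElement]
      exact (QuotientGroup.eq_one_iff _).mpr this
    have h1 : q (⁅x, g⁆ ^ n) = 1 := by
      rw [map_pow, map_commutatorElement, ← commutatorElement_pow_left_of_mem_center hcen,
        ← map_pow, ← map_commutatorElement]
      exact (QuotientGroup.eq_one_iff _).mpr (Subgroup.mem_upperCentralSeries_succ_iff.mp hxn g)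
    exact (QuotientGroup.eq_one_iff _).mp h1

theorem mem_center_of_pow_mem_center {G : Type*} [Group G] [Group.IsNilpotent G]
    (htf : ∀ g : G, IsOfFinOrder g → g = 1) {x : G} {n : ℕ} (hn : 0 < n)
    (hx : x ^ n ∈ Subgroup.center G) : x ∈ Subgroup.center G := by
  rw [← Subgroup.upperCentralSeries_one] at hx ⊢
  have key : ∀ j, x ∈ Subgroup.upperCentralSeries G (j + 1) →
      x ∈ Subgroup.upperCentralSeries G 1 := by
    intro j
    induction j with
    | zero => exact id
    | succ j ih =>
      exact fun h => ih (mem_upperCentralSeries_of_pow_mem htf hn _ x h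
        (Subgroup.upperCentralSeries_mono G (by omega) hx))
  obtain ⟨c, hc⟩ := Group.IsNilpotent.nilpotent G
  refine key c (Subgroup.upperCentralSeries_mono G (Nat.le_succ c) ?_)
  rw [hc]
  trivial

theorem torsionFree_quotient_center {G : Type*} [Group G] [Group.IsNilpotent G]
    (htf : ∀ g : G, IsOfFinOrder g → g = 1) (g : G ⧸ Subgroup.center G) (hg : IsOfFinOrder g) :
    g = 1 := by
  obtain ⟨g, rfl⟩ := QuotientGroup.mk'_surjective _ g
  obtain ⟨n, hn, h⟩ := isOfFinOrder_iff_pow_eq_one.mp hg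
  rw [← map_pow] at h
  exact (QuotientGroup.eq_one_iff g).mpr
    (mem_center_of_pow_mem_center htf hn ((QuotientGroup.eq_one_iff _).mp h))

/-- In a torsion-free nilpotent group, centralizers are isolated. -/
theorem commute_of_commute_pow {G : Type*} [Group G] [Group.IsNilpotent G]
    (htf : ∀ g : G, IsOfFinOrder g → g = 1) {x y : G} {n : ℕ} (hn : 0 < n)
    (h : Commute (x ^ n) y) : Commute x y := by
  revert htf x y
  refine Group.nilpotent_center_quotient_ind (P := fun G _ _ =>
    (∀ g : G, IsOfFinOrder g → g = 1) → ∀ {x y : G}, Commute (x ^ n) y → Commute x y) G ?_ ?_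
  · intro G _ _ _ x y _
    exact Subsingleton.elim _ _
  · intro G _ _ ih htf x y h
    let q := QuotientGroup.mk' (Subgroup.center G)
    have h1 : Commute (q x) (q y) := by
      refine ih (torsionFree_quotient_center htf) ?_
      rw [← map_pow]
      exact h.map q
    have hcen : ⁅x, y⁆ ∈ Subgroup.center G := by
      rw [← QuotientGroup.eq_one_iff]
      change q ⁅x, y⁆ = 1
      rw [map_commutatorElement, h1.commutator_eq]
    have h2 : ⁅x, y⁆ ^ n = 1 := by
      rw [← commutatorElement_pow_left_of_mem_center hcen, h.commutator_eq]
    exact commutatorElement_eq_one_iff_commute.mp (eq_one_of_pow_eq_one htf hn h2)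

/-- In a torsion-free nilpotent group, an element commuting with a subgroup of finite index is
central. -/
theorem mem_center_of_forall_commute {G : Type*} [Group G] [Group.IsNilpotent G]
    (htf : ∀ g : G, IsOfFinOrder g → g = 1) {K : Subgroup G} (hK : K.index ≠ 0) {z : G}
    (h : ∀ k ∈ K, Commute k z) : z ∈ Subgroup.center G := by
  rw [Subgroup.mem_center_iff]
  intro g
  obtain ⟨n, hn, -, hg⟩ := Subgroup.exists_pow_mem_of_index_ne_zero hK g
  exact commute_of_commute_pow htf hn (h _ hg)

/-! ### Powers of commutators -/

theorem exists_pow_mem_of_mem_closure {G : Type*} [Group G] {A : Subgroup G} {S : Set G}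
    (hS : S ⊆ Subgroup.center G) (h : ∀ s ∈ S, ∃ k, 0 < k ∧ s ^ k ∈ A) {x : G}
    (hx : x ∈ Subgroup.closure S) : ∃ k, 0 < k ∧ x ^ k ∈ A := by
  induction hx using Subgroup.closure_induction with
  | mem s hs => exact h s hs
  | one => exact ⟨1, one_pos, by simp⟩
  | mul x y hx _ ihx ihy =>
    obtain ⟨k, hk, hxk⟩ := ihx
    obtain ⟨l, hl, hyl⟩ := ihy
    have hxc : x ∈ Subgroup.center G := (Subgroup.closure_le _).mpr hS hx
    have hc : Commute x y := (Subgroup.mem_center_iff.mp hxc y).symm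
    refine ⟨k * l, Nat.mul_pos hk hl, ?_⟩
    rw [hc.mul_pow, pow_mul, pow_mul' y]
    exact mul_mem (pow_mem hxk _) (pow_mem hyl _)
  | inv x _ ih =>
    obtain ⟨k, hk, hxk⟩ := ih
    exact ⟨k, hk, by rw [inv_pow]; exact inv_mem hxk⟩

/-- The case `T = ⊤` of `exists_pow_mem_commutator`, by induction on the length of the lower central
series. -/
theorem exists_pow_mem_commutator_of_lowerCentralSeries_eq_bot (n : ℕ) :
    ∀ {G : Type*} [Group G], (⊤ : Subgroup G).lowerCentralSeries (n + 1) = ⊥ →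
      ∀ {E : Subgroup G}, (∀ t : G, ∃ k, 0 < k ∧ t ^ k ∈ E) →
        ∀ g ∈ commutator G, ∃ k, 0 < k ∧ g ^ k ∈ ⁅E, E⁆ := by
  induction n with
  | zero =>
    intro G _ h E _ g hg
    have hg1 : g ∈ (⊥ : Subgroup G) := h ▸ hg
    exact ⟨1, one_pos, by rw [Subgroup.mem_bot.mp hg1, one_pow]; exact one_mem _⟩
  | succ n ih =>
    intro G _ h E hE g hg
    have hcen : (⊤ : Subgroup G).lowerCentralSeries (n + 1) ≤ Subgroup.center G :=
      Subgroup.commutator_top_right_eq_bot_iff_le_center.mp h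
    -- The last nontrivial term is generated by central commutators `⁅y, x⁆`, and
    -- `⁅y, x⁆ ^ (a * b) = ⁅y ^ a, x ^ b⁆`.
    have hlast : ∀ z ∈ (⊤ : Subgroup G).lowerCentralSeries (n + 1),
        ∃ k, 0 < k ∧ z ^ k ∈ ⁅E, E⁆ := by
      intro z hz
      refine exists_pow_mem_of_mem_closure (S := {x | ∃ p ∈
        (⊤ : Subgroup G).lowerCentralSeries n, ∃ q ∈ (⊤ : Subgroup G), ⁅p, q⁆ = x}) ?_ ?_ hz
      · exact fun s hs => hcen (Subgroup.subset_closure hs)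
      · rintro _ ⟨y, hy, x, hx, rfl⟩
        obtain ⟨a, ha, hya⟩ := hE y
        obtain ⟨b, hb, hxb⟩ := hE x
        have hc : ⁅y, x⁆ ∈ Subgroup.center G :=
          hcen (Subgroup.commutator_mem_commutator hy hx)
        refine ⟨a * b, Nat.mul_pos ha hb, ?_⟩
        have hc' : ⁅y ^ a, x⁆ ∈ Subgroup.center G := by
          rw [commutatorElement_pow_left_of_mem_center hc]; exact pow_mem hc a
        rw [pow_mul, ← commutatorElement_pow_left_of_mem_center hc,
          ← commutatorElement_pow_right_of_mem_center hc']
        exact Subgroup.commutator_mem_commutator hya hxb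
    let N := (⊤ : Subgroup G).lowerCentralSeries (n + 1)
    let q := QuotientGroup.mk' N
    have hq : Function.Surjective q := QuotientGroup.mk'_surjective N
    have hN : (⊤ : Subgroup (G ⧸ N)).lowerCentralSeries (n + 1) = ⊥ := by
      rw [← Subgroup.map_top_of_surjective q hq, ← Subgroup.map_lowerCentralSeries,
        Subgroup.map_eq_bot_iff, QuotientGroup.ker_mk']
    obtain ⟨k, hk, hgk⟩ := ih hN (E := E.map q) (fun t => by
      obtain ⟨t, rfl⟩ := hq t
      obtain ⟨k, hk, htk⟩ := hE t
      exact ⟨k, hk, by rw [← map_pow]; exact Subgroup.mem_map_of_mem q htk⟩) (q g) (by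
        have := Subgroup.mem_map_of_mem q hg
        rw [commutator_def, Subgroup.map_commutator] at this
        exact Subgroup.commutator_mono le_top le_top this)
    rw [← map_pow, ← Subgroup.map_commutator] at hgk
    obtain ⟨e, he, heq⟩ := hgk
    have hz : e⁻¹ * g ^ k ∈ N := (QuotientGroup.eq (s := N)).mp heq
    obtain ⟨l, hl, hzl⟩ := hlast _ hz
    refine ⟨k * l, Nat.mul_pos hk hl, ?_⟩
    have hc : Commute e (e⁻¹ * g ^ k) := Subgroup.mem_center_iff.mp (hcen hz) e
    rw [pow_mul, ← mul_inv_cancel_left e (g ^ k), hc.mul_pow]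
    exact mul_mem (pow_mem he l) hzl

/-- If every element of a subgroup `T` of a nilpotent group has a positive power in `E`, then every
element of `⁅T, T⁆` has a positive power in `⁅E, E⁆`. -/
theorem exists_pow_mem_commutator {G : Type*} [Group G] [Group.IsNilpotent G]
    {T E : Subgroup G} (h : ∀ t ∈ T, ∃ k, 0 < k ∧ t ^ k ∈ E) {g : G} (hg : g ∈ ⁅T, T⁆) :
    ∃ k, 0 < k ∧ g ^ k ∈ ⁅E, E⁆ := by
  obtain ⟨c, hc⟩ := Subgroup.nilpotent_iff_lowerCentralSeries.mp
    (inferInstance : Group.IsNilpotent T)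
  have hc' : (⊤ : Subgroup T).lowerCentralSeries (c + 1) = ⊥ :=
    le_bot_iff.mp (hc ▸ Subgroup.lowerCentralSeries_antitone _ (Nat.le_succ c))
  rw [← Subgroup.map_subtype_commutator] at hg
  obtain ⟨g, hg, rfl⟩ := hg
  obtain ⟨k, hk, hgk⟩ := exists_pow_mem_commutator_of_lowerCentralSeries_eq_bot c hc'
    (E := E.subgroupOf T) (fun t => by
      obtain ⟨k, hk, htk⟩ := h t t.2
      exact ⟨k, hk, Subgroup.mem_subgroupOf.mpr (by simpa using htk)⟩) g hg
  refine ⟨k, hk, ?_⟩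
  have := Subgroup.mem_map_of_mem T.subtype hgk
  rw [Subgroup.map_commutator, map_pow] at this
  exact Subgroup.commutator_mono (Subgroup.map_comap_le _ _) (Subgroup.map_comap_le _ _) this

/-! ### Rank functions -/

/-- `G` admits a rank function: a monotone map from its subgroups to `ℕ` that drops strictly
from a subgroup to any of its subgroups of infinite index. For polycyclic groups the Hirsch length
is such a function. -/
def HasRankFunction (G : Type*) [Group G] : Prop :=
  ∃ ρ : Subgroup G → ℕ, ∀ A B : Subgroup G, A ≤ B →
    ρ A ≤ ρ B ∧ (A.relIndex B = 0 → ρ A < ρ B)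

theorem relIndex_sup_normal_inf_ne_zero {G : Type*} [Group G] (A B N : Subgroup G) [N.Normal]
    (hAB : A ≤ B) (h : A.relIndex (B ⊓ N) ≠ 0) : A.relIndex (B ⊓ (A ⊔ N)) ≠ 0 := by
  have hfin : Finite ((B ⊓ N : Subgroup G) ⧸ A.subgroupOf (B ⊓ N)) :=
    (Nat.finite_of_card_ne_zero h)
  have hle : B ⊓ N ≤ B ⊓ (A ⊔ N) := inf_le_inf_left _ le_sup_right
  -- `B ⊓ (A ⊔ N) = (B ⊓ N) * A`, so the cosets of `A` in it are represented in `B ⊓ N`.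
  let φ : (B ⊓ N : Subgroup G) ⧸ A.subgroupOf (B ⊓ N) →
      (B ⊓ (A ⊔ N) : Subgroup G) ⧸ A.subgroupOf (B ⊓ (A ⊔ N)) :=
    Subgroup.quotientSubgroupOfEmbeddingOfLE A hle
  have hφ : Function.Surjective φ := by
    intro x
    induction x using QuotientGroup.induction_on with
    | H x =>
    obtain ⟨x, hxB, hx⟩ := x
    obtain ⟨n, hn, a, ha, rfl⟩ := Subgroup.mem_sup_of_normal_left.mp
      (show x ∈ N ⊔ A from sup_comm A N ▸ hx)
    have hnB : n ∈ B := (mul_mem_cancel_right (hAB ha)).mp hxB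
    refine ⟨QuotientGroup.mk ⟨n, hnB, hn⟩, ?_⟩
    refine (QuotientGroup.eq).mpr ?_
    rw [Subgroup.mem_subgroupOf]
    simpa using ha
  have := Finite.of_surjective φ hφ
  exact Nat.card_pos.ne'

/-- Rank functions of `N` and `G ⧸ N` add up to one of `G`, as a subgroup with finite index both in
`N` and modulo `N` has finite index. -/
theorem HasRankFunction.of_quotient {G : Type*} [Group G] (N : Subgroup G) [N.Normal]
    (h1 : HasRankFunction N) (h2 : HasRankFunction (G ⧸ N)) : HasRankFunction G := by
  obtain ⟨ρ, hρ⟩ := h1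
  obtain ⟨σ, hσ⟩ := h2
  refine ⟨fun K => ρ (K.subgroupOf N) + σ (K.map (QuotientGroup.mk' N)), fun A B hAB => ?_⟩
  have hs : A.subgroupOf N ≤ B.subgroupOf N := Subgroup.comap_mono hAB
  have hm : A.map (QuotientGroup.mk' N) ≤ B.map (QuotientGroup.mk' N) := Subgroup.map_mono hAB
  refine ⟨add_le_add (hρ _ _ hs).1 (hσ _ _ hm).1, fun h0 => ?_⟩
  by_cases hN : (A.subgroupOf N).relIndex (B.subgroupOf N) = 0
  · exact add_lt_add_of_lt_of_le ((hρ _ _ hs).2 hN) (hσ _ _ hm).1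
  · refine add_lt_add_of_le_of_lt (hρ _ _ hs).1 ((hσ _ _ hm).2 ?_)
    by_contra hQ
    rw [Subgroup.relIndex_map_map, QuotientGroup.ker_mk'] at hQ
    rw [Subgroup.subgroupOf, Subgroup.relIndex_comap, Subgroup.subgroupOf_map_subtype] at hN
    have hA := relIndex_sup_normal_inf_ne_zero A B N hAB hN
    have hB : (B ⊓ (A ⊔ N)).relIndex B ≠ 0 := by
      rw [inf_comm, Subgroup.inf_relIndex_right]
      exact fun h => hQ (Subgroup.relIndex_eq_zero_of_le_right le_sup_left h)
    exact Subgroup.relIndex_ne_zero_trans hA hB h0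

/-- The rank of the underlying `ℤ`-module is a rank function: a subgroup of the same rank has a
finitely generated torsion quotient, which is finite. -/
theorem HasRankFunction.of_commGroup_fg (C : Type*) [CommGroup C] [Group.FG C] :
    HasRankFunction C := by
  have : Module.Finite ℤ (Additive C) :=
    Module.Finite.iff_addGroup_fg.mpr inferInstance
  have : IsNoetherian ℤ (Additive C) := isNoetherian_of_isNoetherianRing_of_finite ℤ _
  let M : Subgroup C → Submodule ℤ (Additive C) := fun K =>
    AddSubgroup.toIntSubmodule K.toAddSubgroup
  refine ⟨fun K => Module.finrank ℤ (M K), fun A B hAB => ?_⟩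
  have hM : M A ≤ M B := fun x hx => hAB hx
  refine ⟨Submodule.finrank_mono hM, fun h0 => lt_of_le_of_ne (Submodule.finrank_mono hM) ?_⟩
  intro heq
  replace heq : Module.finrank ℤ (M A) = Module.finrank ℤ (M B) := heq
  let A' : Submodule ℤ (M B) := (M A).submoduleOf (M B)
  have h1 : Module.finrank ℤ A' = Module.finrank ℤ (M A) :=
    LinearEquiv.finrank_eq (Submodule.submoduleOfEquivOfLe hM)
  have h2 := Submodule.finrank_quotient_add_finrank A'
  have h3 : Module.finrank ℤ (M B ⧸ A') = 0 := by omega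
  have h4 : Finite (M B ⧸ A') :=
    Module.finite_of_fg_torsion _ (Module.finrank_eq_zero_iff_isTorsion.mp h3)
  let φ : M B ⧸ A' → B ⧸ A.subgroupOf B :=
    Quotient.map' (fun x => (⟨x.1.toMul, x.2⟩ : B)) (by
      intro x y hxy
      have hxy' := QuotientAddGroup.leftRel_apply.mp hxy
      exact QuotientGroup.leftRel_apply.mpr hxy')
  have hφ : Function.Surjective φ := by
    intro x
    induction x using QuotientGroup.induction_on with
    | H x => exact ⟨Submodule.Quotient.mk ⟨Additive.ofMul x.1, x.2⟩, rfl⟩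
  have := Finite.of_surjective φ hφ
  exact Nat.card_pos.ne' h0

/-! ### Finitely generated nilpotent groups -/

/-- A finite generating set of `γ` modulo `⁅γ, G⁆`, commuted with a finite generating set of `G`,
gives a finite generating set of `⁅γ, G⁆` modulo `⁅⁅γ, G⁆, G⁆`. -/
theorem exists_finite_closure_sup_lowerCentralSeries {G : Type*} [Group G] (hfg : Group.FG G)
    (i : ℕ) : ∃ S : Set G, S.Finite ∧ (⊤ : Subgroup G).lowerCentralSeries i =
      Subgroup.closure S ⊔ (⊤ : Subgroup G).lowerCentralSeries (i + 1) := by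
  obtain ⟨X, hX, hXfin⟩ := Group.fg_iff.mp hfg
  induction i with
  | zero => exact ⟨X, hXfin, by rw [hX, top_sup_eq, Subgroup.lowerCentralSeries_zero]⟩
  | succ i ih =>
    obtain ⟨S, hS, hSi⟩ := ih
    let γ := (⊤ : Subgroup G).lowerCentralSeries
    refine ⟨Set.image2 (fun y x => ⁅y, x⁆) S X, hS.image2 _ hXfin, ?_⟩
    set M := Subgroup.closure (Set.image2 (fun y x => ⁅y, x⁆) S X) ⊔ γ (i + 2) with hMdef
    have hSγ : S ⊆ γ i := fun s hs => by
      change s ∈ (⊤ : Subgroup G).lowerCentralSeries i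
      rw [hSi]
      exact Subgroup.mem_sup_left (Subgroup.subset_closure hs)
    have hMle : M ≤ γ (i + 1) := by
      refine sup_le ((Subgroup.closure_le _).mpr ?_) (Subgroup.lowerCentralSeries_antitone _
        (Nat.le_succ _))
      rintro _ ⟨y, hy, x, -, rfl⟩
      exact Subgroup.commutator_mem_commutator (hSγ hy) (Subgroup.mem_top x)
    have hMn : M.Normal := Subgroup.commutator_top_right_le_iff.mp
      ((Subgroup.commutator_mono hMle le_rfl).trans le_sup_right)
    refine le_antisymm ?_ hMle
    have hright : ∀ y ∈ S, ∀ x : G, ⁅y, x⁆ ∈ M := by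
      intro y hy x
      have hx : x ∈ Subgroup.closure X := hX ▸ Subgroup.mem_top x
      induction hx using Subgroup.closure_induction with
      | mem x hx => exact Subgroup.mem_sup_left (Subgroup.subset_closure ⟨y, hy, x, hx, rfl⟩)
      | one => simp
      | mul a b _ _ iha ihb =>
        rw [commutatorElement_mul_right_eq_mul_conj]
        simpa [mul_assoc] using mul_mem iha (hMn.conj_mem _ ihb a)
      | inv a _ iha =>
        rw [commutatorElement_inv_right, ← commutatorElement_inv]
        simpa using hMn.conj_mem _ (inv_mem iha) a⁻¹
    have hclosure : ∀ s ∈ Subgroup.closure S, ∀ x : G, ⁅s, x⁆ ∈ M := by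
      intro s hs x
      induction hs using Subgroup.closure_induction with
      | mem s hs => exact hright s hs x
      | one => simp
      | mul a b _ _ iha ihb =>
        rw [commutatorElement_mul_left_eq_conj_mul]
        exact mul_mem (hMn.conj_mem _ ihb a) iha
      | inv a _ iha =>
        rw [commutatorElement_inv_left, ← commutatorElement_inv]
        simpa using hMn.conj_mem _ (inv_mem iha) a⁻¹
    change ⁅(⊤ : Subgroup G).lowerCentralSeries i, ⊤⁆ ≤ M
    rw [Subgroup.commutator_le]
    intro y hy x _
    rw [hSi] at hy
    obtain ⟨s, hs, w, hw, rfl⟩ := Subgroup.mem_sup_of_normal_right.mp hy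
    rw [commutatorElement_mul_left_eq_conj_mul]
    refine mul_mem (hMn.conj_mem _ ?_ s) (hclosure s hs x)
    exact Subgroup.mem_sup_right (Subgroup.commutator_mem_commutator hw (Subgroup.mem_top x))

theorem hasRankFunction_of_lowerCentralSeries_eq_bot (n : ℕ) :
    ∀ {G : Type*} [Group G], Group.FG G → (⊤ : Subgroup G).lowerCentralSeries n = ⊥ →
      HasRankFunction G := by
  induction n with
  | zero =>
    intro G _ _ h
    refine ⟨fun _ => 0, fun A B _ => ⟨le_rfl, fun h0 => ?_⟩⟩
    have hsub : Subsingleton G := Subgroup.subsingleton_iff.mp (subsingleton_of_bot_eq_top h.symm)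
    rw [Subsingleton.elim A B, Subgroup.relIndex_self] at h0
    exact absurd h0 one_ne_zero
  | succ n ih =>
    intro G _ hfg h
    let N := (⊤ : Subgroup G).lowerCentralSeries n
    have hcen : N ≤ Subgroup.center G := Subgroup.commutator_top_right_eq_bot_iff_le_center.mp h
    have hNfg : Group.FG N := by
      obtain ⟨S, hS, hSn⟩ := exists_finite_closure_sup_lowerCentralSeries hfg n
      rw [h, sup_bot_eq] at hSn
      exact (Group.fg_iff_subgroup_fg N).mpr ((Subgroup.fg_iff N).mpr ⟨S, hSn.symm, hS⟩)
    have hN : (⊤ : Subgroup (G ⧸ N)).lowerCentralSeries n = ⊥ := by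
      have hq := QuotientGroup.mk'_surjective N
      rw [← Subgroup.map_top_of_surjective _ hq, ← Subgroup.map_lowerCentralSeries,
        Subgroup.map_eq_bot_iff, QuotientGroup.ker_mk']
    let _ : CommGroup N :=
      { (inferInstance : Group N) with
        mul_comm := fun a b => Subtype.ext (Subgroup.mem_center_iff.mp (hcen b.2) a) }
    exact .of_quotient N (.of_commGroup_fg N) (ih inferInstance hN)

/-- An injective homomorphism into a group with a rank function, from a subgroup of finite index,
has image of finite index. -/
theorem HasRankFunction.index_range_ne_zero {G : Type*} [Group G] (hG : HasRankFunction G)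
    {H : Subgroup G} (hH : H.index ≠ 0) {f : H →* G} (hf : Function.Injective f) :
    f.range.index ≠ 0 := by
  intro h0
  obtain ⟨ρ, hρ⟩ := hG
  let F : Subgroup G → Subgroup G := fun K => (K.subgroupOf H).map f
  have hFmono : Monotone F := fun A B h => Subgroup.map_mono (Subgroup.comap_mono h)
  have hle : ∀ n, F^[n + 1] ⊤ ≤ F^[n] ⊤ := by
    intro n
    induction n with
    | zero => exact le_top
    | succ n ih =>
      rw [Function.iterate_succ_apply' F (n + 1), Function.iterate_succ_apply' F n] at *
      exact hFmono ih
  -- The iterated images of `G` form a descending chain with infinite indices.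
  have hrel : ∀ n, (F^[n + 1] ⊤).relIndex (F^[n] ⊤) = 0 := by
    intro n
    induction n with
    | zero =>
      have : F ⊤ = f.range := by rw [MonoidHom.range_eq_map]; rfl
      rw [Function.iterate_one, this]
      simpa using h0
    | succ n ih =>
      rw [Function.iterate_succ_apply' F (n + 1), Function.iterate_succ_apply' F n] at *
      set K := F^[n] ⊤
      by_contra hne
      change ((F K).subgroupOf H |>.map f).relIndex ((K.subgroupOf H).map f) ≠ 0 at hne
      rw [Subgroup.relIndex_map_map_of_injective _ _ hf, Subgroup.subgroupOf,
        Subgroup.relIndex_comap, Subgroup.subgroupOf_map_subtype] at hne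
      refine Subgroup.relIndex_ne_zero_trans hne ?_ ih
      rw [inf_comm, Subgroup.inf_relIndex_right]
      exact fun h => hH (Subgroup.index_eq_zero_of_relIndex_eq_zero h)
  have hlt : ∀ n, ρ (F^[n + 1] ⊤) < ρ (F^[n] ⊤) := fun n => (hρ _ _ (hle n)).2 (hrel n)
  have hbound : ∀ n, ρ (F^[n] ⊤) + n ≤ ρ ⊤ := by
    intro n
    induction n with
    | zero => simp
    | succ n ih => have := hlt n; omega
  have := hbound (ρ ⊤ + 1)
  omega

/-! ### The largest invariant subgroup -/

/-- The subgroup generated by all `f`-invariant subgroups of `G`, normal or not. It consists of the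
elements on which all iterates of `f` are defined. -/
def invariantCore {G : Type*} [Group G] {H : Subgroup G} (f : H →* G) : Subgroup G :=
  sSup {K : Subgroup G | IsFInvariant f K}

theorem isFInvariant_iff {G : Type*} [Group G] {H : Subgroup G} {f : H →* G} {K : Subgroup G} :
    IsFInvariant f K ↔ ∀ x ∈ K, ∃ hx : x ∈ H, f ⟨x, hx⟩ ∈ K := by
  constructor
  · exact fun h x hx => ⟨h.1 hx, h.2 ⟨⟨x, h.1 hx⟩, hx, rfl⟩⟩
  · refine fun h => ⟨fun x hx => (h x hx).1, ?_⟩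
    rintro _ ⟨⟨x, hxH⟩, hx, rfl⟩
    exact (h x hx).2

theorem isFInvariant_closure {G : Type*} [Group G] {H : Subgroup G} {f : H →* G} {S : Set G}
    (h : ∀ x ∈ S, ∃ hx : x ∈ H, f ⟨x, hx⟩ ∈ Subgroup.closure S) :
    IsFInvariant f (Subgroup.closure S) := by
  rw [isFInvariant_iff]
  intro x hx
  induction hx using Subgroup.closure_induction with
  | mem x hx => exact h x hx
  | one => exact ⟨one_mem H, (map_one f).symm ▸ one_mem (Subgroup.closure S)⟩
  | mul x y _ _ ihx ihy =>
    obtain ⟨hx, hfx⟩ := ihx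
    obtain ⟨hy, hfy⟩ := ihy
    refine ⟨mul_mem hx hy, ?_⟩
    rw [show (⟨x * y, mul_mem hx hy⟩ : H) = ⟨x, hx⟩ * ⟨y, hy⟩ from rfl, map_mul]
    exact mul_mem hfx hfy
  | inv x _ ih =>
    obtain ⟨hx, hfx⟩ := ih
    refine ⟨inv_mem hx, ?_⟩
    rw [show (⟨x⁻¹, inv_mem hx⟩ : H) = ⟨x, hx⟩⁻¹ from rfl, map_inv]
    exact inv_mem hfx

theorem isFInvariant_invariantCore {G : Type*} [Group G] {H : Subgroup G} (f : H →* G) :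
    IsFInvariant f (invariantCore f) := by
  rw [invariantCore, sSup_eq_iSup', Subgroup.iSup_eq_closure]
  refine isFInvariant_closure fun x hx => ?_
  obtain ⟨K, hxK⟩ := Set.mem_iUnion.mp hx
  obtain ⟨hxH, hfx⟩ := isFInvariant_iff.mp K.2 x hxK
  exact ⟨hxH, Subgroup.subset_closure (Set.mem_iUnion.mpr ⟨K, hfx⟩)⟩

theorem le_invariantCore {G : Type*} [Group G] {H : Subgroup G} {f : H →* G} {K : Subgroup G}
    (h : IsFInvariant f K) : K ≤ invariantCore f := le_sSup h

/-! ### Passing to the quotient by the center -/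

/-- A virtual endomorphism of `G` whose values on `H ⊓ N` lie in `N` induces one of `G ⧸ N`, with
domain the image of `H`. -/
theorem exists_virtualEnd_quotient {G : Type*} [Group G] {H : Subgroup G} (f : H →* G)
    (N : Subgroup G) [N.Normal] (hN : ∀ h : H, (h : G) ∈ N → f h ∈ N) :
    ∃ g : H.map (QuotientGroup.mk' N) →* G ⧸ N, ∀ h : H,
      g ⟨QuotientGroup.mk' N h, Subgroup.mem_map_of_mem _ h.2⟩ = QuotientGroup.mk' N (f h) := by
  let q := QuotientGroup.mk' N
  let π : H →* H.map q := q.subgroupMap H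
  have hπ : Function.Surjective π := q.subgroupMap_surjective H
  have hker : π.ker ≤ (q.comp f).ker := by
    intro h hh
    have h1 : q h = 1 := congrArg Subtype.val (MonoidHom.mem_ker.mp hh)
    exact (QuotientGroup.eq_one_iff (f h)).mpr (hN h ((QuotientGroup.eq_one_iff (h : G)).mp h1))
  exact ⟨π.liftOfSurjective hπ ⟨q.comp f, hker⟩, fun h =>
    π.liftOfRightInverse_comp_apply _ (Function.rightInverse_surjInv hπ) ⟨q.comp f, hker⟩ h⟩

/-- The preimage `E` in `G` of an invariant subgroup for the virtual endomorphism induced on the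
quotient by a central subgroup has `f`-invariant commutator subgroup, because `E` is the product of
`E ⊓ H` and that central subgroup. -/
theorem isFInvariant_commutator {G : Type*} [Group G] {H : Subgroup G} {f : H →* G}
    {E : Subgroup G} (hE : E ≤ H ⊔ Subgroup.center G) (hZ : Subgroup.center G ≤ E)
    (hf : ∀ h : H, (h : G) ∈ E → f h ∈ E) : IsFInvariant f ⁅E, E⁆ := by
  have hdec : ∀ e ∈ E, ∃ h : H, (h : G) ∈ E ∧ ∃ z ∈ Subgroup.center G, (h : G) * z = e := by
    intro e he
    obtain ⟨h, hh, z, hz, rfl⟩ := Subgroup.mem_sup_of_normal_right.mp (hE he)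
    exact ⟨⟨h, hh⟩, (mul_mem_cancel_right (hZ hz)).mp he, z, hz, rfl⟩
  rw [Subgroup.commutator_def]
  refine isFInvariant_closure ?_
  rintro _ ⟨a, ha, b, hb, rfl⟩
  obtain ⟨a, haE, z, hz, rfl⟩ := hdec a ha
  obtain ⟨b, hbE, w, hw, rfl⟩ := hdec b hb
  rw [commutatorElement_mul_mul_of_mem_center hz hw]
  refine ⟨(⁅a, b⁆ : H).2, Subgroup.subset_closure ⟨f a, hf a haE, f b, hf b hbE, ?_⟩⟩
  exact (map_commutatorElement f a b).symm

/-- If the center does not lie in `H`, then the image of `H` modulo the center has an index with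
fewer prime factors. -/
theorem cardFactors_index_map_center_lt {G : Type*} [Group G] {H : Subgroup G}
    (hH : H.index ≠ 0) (hZ : ¬ Subgroup.center G ≤ H) :
    ArithmeticFunction.cardFactors (H.map (QuotientGroup.mk' (Subgroup.center G))).index <
      ArithmeticFunction.cardFactors H.index := by
  have hidx : (H.map (QuotientGroup.mk' (Subgroup.center G))).index =
      (H ⊔ Subgroup.center G).index := by
    rw [Subgroup.index_map, QuotientGroup.ker_mk', MonoidHom.range_eq_top.mpr
      (QuotientGroup.mk'_surjective _), Subgroup.index_top, mul_one]
  have hmul := Subgroup.relIndex_mul_index (le_sup_left : H ≤ H ⊔ Subgroup.center G)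
  have h0 : H.relIndex (H ⊔ Subgroup.center G) * (H ⊔ Subgroup.center G).index ≠ 0 := hmul ▸ hH
  have h1 : H.relIndex (H ⊔ Subgroup.center G) ≠ 1 := fun h =>
    hZ (le_sup_right.trans (Subgroup.relIndex_eq_one.mp h))
  rw [hidx, ← hmul, ArithmeticFunction.cardFactors_mul (left_ne_zero_of_mul h0)
    (right_ne_zero_of_mul h0)]
  have : ArithmeticFunction.cardFactors (H.relIndex (H ⊔ Subgroup.center G)) ≠ 0 := by
    rw [Ne, ArithmeticFunction.cardFactors_eq_zero_iff_eq_zero_or_one]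
    exact not_or.mpr ⟨left_ne_zero_of_mul h0, h1⟩
  omega

/-- Every element of the `Ω(m)`-th derived subgroup has a positive power in the invariant core. No
simplicity is assumed: it is not inherited by the quotient by the center, whereas the present
statement passes to that quotient and back. -/
theorem exists_pow_mem_invariantCore {G : Type*} [Group G] [Group.IsNilpotent G]
    (htf : ∀ g : G, IsOfFinOrder g → g = 1) {H : Subgroup G} (hH : H.index ≠ 0) (f : H →* G)
    (hf : f.range.index ≠ 0) :
    ∀ x ∈ derivedSeries G (ArithmeticFunction.cardFactors H.index),
      ∃ k, 0 < k ∧ x ^ k ∈ invariantCore f := by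
  revert htf H
  refine Group.nilpotent_center_quotient_ind (P := fun G _ _ =>
    (∀ g : G, IsOfFinOrder g → g = 1) → ∀ {H : Subgroup G}, H.index ≠ 0 → ∀ (f : H →* G),
      f.range.index ≠ 0 → ∀ x ∈ derivedSeries G (ArithmeticFunction.cardFactors H.index),
        ∃ k, 0 < k ∧ x ^ k ∈ invariantCore f) G ?_ ?_
  · intro G _ _ _ H _ f _ x _
    exact ⟨1, one_pos, by rw [Subsingleton.elim (x ^ 1) 1]; exact one_mem _⟩
  · intro G _ _ ih htf H hH f hf x hx
    let Z := Subgroup.center G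
    let q := QuotientGroup.mk' Z
    have hq : Function.Surjective q := QuotientGroup.mk'_surjective Z
    have hfZ : ∀ h : H, (h : G) ∈ Z → f h ∈ Z := by
      refine fun h hh => mem_center_of_forall_commute htf hf ?_
      rintro _ ⟨k, rfl⟩
      have : k * h = h * k := Subtype.ext (Subgroup.mem_center_iff.mp hh k)
      exact Commute.map (f := f) this
    obtain ⟨g, hg⟩ := exists_virtualEnd_quotient f Z hfZ
    have hgrange : g.range.index ≠ 0 := by
      have hle : f.range.map q ≤ g.range := by
        rintro _ ⟨_, ⟨h, rfl⟩, rfl⟩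
        exact ⟨_, hg h⟩
      have hne : (f.range.map q).index ≠ 0 :=
        ne_zero_of_dvd_ne_zero hf (Subgroup.index_map_dvd _ hq)
      exact ne_zero_of_dvd_ne_zero hne (Subgroup.index_dvd_of_le hle)
    have hHq : (H.map q).index ≠ 0 := ne_zero_of_dvd_ne_zero hH (Subgroup.index_map_dvd _ hq)
    let E := (invariantCore g).comap q
    have hcore := isFInvariant_invariantCore g
    have hpow : ∀ t ∈ derivedSeries G (ArithmeticFunction.cardFactors (H.map q).index),
        ∃ k, 0 < k ∧ t ^ k ∈ E := by
      intro t ht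
      obtain ⟨k, hk, hkt⟩ := ih (torsionFree_quotient_center htf) hHq g hgrange (q t)
        (map_derivedSeries_le_derivedSeries q _ (Subgroup.mem_map_of_mem q ht))
      exact ⟨k, hk, by rw [Subgroup.mem_comap, map_pow]; exact hkt⟩
    have hEle : E ≤ H ⊔ Z := by
      have := Subgroup.comap_mono (f := q) hcore.1
      rwa [Subgroup.comap_map_eq, QuotientGroup.ker_mk'] at this
    have hEf : ∀ h : H, (h : G) ∈ E → f h ∈ E := by
      intro h hh
      obtain ⟨_, hgh⟩ := isFInvariant_iff.mp hcore (q h) hh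
      rw [Subgroup.mem_comap, ← hg h]
      exact hgh
    by_cases hZ : Z ≤ H
    · have hidx : (H.map q).index = H.index := Subgroup.index_map_eq _ hq
        (by rwa [QuotientGroup.ker_mk'])
      rw [hidx] at hpow
      have hEH : E ≤ H := hEle.trans (sup_le le_rfl hZ)
      have hE : IsFInvariant f E := isFInvariant_iff.mpr fun x hx => ⟨hEH hx, hEf ⟨x, hEH hx⟩ hx⟩
      obtain ⟨k, hk, hkx⟩ := hpow x hx
      exact ⟨k, hk, le_invariantCore hE hkx⟩
    · have hZE : Z ≤ E := fun z hz => by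
        rw [Subgroup.mem_comap, show q z = 1 from (QuotientGroup.eq_one_iff z).mpr hz]
        exact one_mem _
      have hx' := derivedSeries_antitone G (Nat.succ_le_of_lt
        (cardFactors_index_map_center_lt hH hZ)) hx
      obtain ⟨k, hk, hkx⟩ := exists_pow_mem_commutator hpow hx'
      exact ⟨k, hk, le_invariantCore (isFInvariant_commutator hEle hZE hEf) hkx⟩

/-! ### Simple virtual endomorphisms -/

theorem IsSimpleVirtualEnd.eq_one_of_mem {G : Type*} [Group G] {H : Subgroup G} {f : H →* G}
    (hf : IsSimpleVirtualEnd f) {K : Subgroup G} (hK : IsFInvariant f K)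
    (hKZ : K ≤ Subgroup.center G) {x : G} (hx : x ∈ K) : x = 1 := by
  have hn : K.Normal := ⟨fun n hn g => by
    rwa [Subgroup.mem_center_iff.mp (hKZ hn) g, mul_inv_cancel_right]⟩
  have : x ∈ fCore f := (fCore_isGreatest f).2 ⟨hn, hK⟩ hx
  rwa [show fCore f = ⊥ from hf, Subgroup.mem_bot] at this

/-- A nontrivial normal subgroup of a nilpotent group meets the center nontrivially. -/
theorem eq_bot_of_inf_center_eq_bot {G : Type*} [Group G] [Group.IsNilpotent G]
    {N : Subgroup G} [N.Normal] (h : N ⊓ Subgroup.center G = ⊥) : N = ⊥ := by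
  have key : ∀ i, N ⊓ Subgroup.upperCentralSeries G i = ⊥ := by
    intro i
    induction i with
    | zero => rw [Subgroup.upperCentralSeries_zero, inf_bot_eq]
    | succ i ih =>
      rw [eq_bot_iff, ← h]
      refine le_inf inf_le_left fun x hx => Subgroup.mem_center_iff.mpr fun g => ?_
      have h1 : ⁅x, g⁆ ∈ N ⊓ Subgroup.upperCentralSeries G i :=
        ⟨Subgroup.commutator_le_left N ⊤
          (Subgroup.commutator_mem_commutator hx.1 (Subgroup.mem_top g)),
          Subgroup.mem_upperCentralSeries_succ_iff.mp hx.2 g⟩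
      rw [ih, Subgroup.mem_bot, commutatorElement_eq_one_iff_mul_comm] at h1
      exact h1.symm
  obtain ⟨c, hc⟩ := Group.IsNilpotent.nilpotent G
  rw [← key c, hc, inf_top_eq]

/-- A simple virtual endomorphism is injective: a nontrivial kernel would meet the center of `H`,
which lies in the center of `G`. -/
theorem IsSimpleVirtualEnd.injective {G : Type*} [Group G] [Group.IsNilpotent G]
    (htf : ∀ g : G, IsOfFinOrder g → g = 1) {H : Subgroup G} (hH : H.index ≠ 0) {f : H →* G}
    (hf : IsSimpleVirtualEnd f) : Function.Injective f := by
  rw [← MonoidHom.ker_eq_bot_iff]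
  refine eq_bot_of_inf_center_eq_bot ?_
  rw [eq_bot_iff]
  rintro h ⟨hker, hcen⟩
  have hZ : (h : G) ∈ Subgroup.center G := mem_center_of_forall_commute htf hH fun k hk =>
    congrArg Subtype.val (Subgroup.mem_center_iff.mp hcen ⟨k, hk⟩)
  have hinv : IsFInvariant f (Subgroup.closure {(h : G)}) := by
    refine isFInvariant_closure ?_
    rintro _ rfl
    refine ⟨h.2, ?_⟩
    rw [show f ⟨h, h.2⟩ = 1 from hker]
    exact one_mem _
  exact Subtype.ext (hf.eq_one_of_mem hinv ((Subgroup.closure_le _).mpr (by simpa using hZ))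
    (Subgroup.subset_closure rfl))

theorem mainTheorem2 {G : Type*} [Group G] (hfg : Group.FG G) (hnil : Group.IsNilpotent G)
    (htf : ∀ g : G, IsOfFinOrder g → g = 1)
    (H : Subgroup G) (m : ℕ) (hm : 1 < m) (hindex : H.index = m)
    (f : H →* G) (hf : IsSimpleVirtualEnd f) :
    groupDerivedLength G ≤ (ArithmeticFunction.cardFactors m : ℕ∞) := by
  subst hindex
  have hH : H.index ≠ 0 := by omega
  obtain ⟨c, hc⟩ := Subgroup.nilpotent_iff_lowerCentralSeries.mp hnil
  have hrange : f.range.index ≠ 0 := (hasRankFunction_of_lowerCentralSeries_eq_bot c hfg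
    hc).index_range_ne_zero hH (hf.injective htf hH)
  have := derivedSeries_normal G (ArithmeticFunction.cardFactors H.index)
  refine iInf₂_le (f := fun (n : ℕ) (_ : derivedSeries G n = ⊥) => (n : ℕ∞)) _
    (eq_bot_of_inf_center_eq_bot (N := derivedSeries G (ArithmeticFunction.cardFactors H.index)) ?_)
  rw [eq_bot_iff]
  rintro z ⟨hz, hzc⟩
  obtain ⟨k, hk, hzk⟩ := exists_pow_mem_invariantCore htf hH f hrange z hz
  -- The central part of the invariant core is invariant, hence trivial.
  have hinv : IsFInvariant f (invariantCore f ⊓ Subgroup.center G) := by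
    rw [isFInvariant_iff]
    rintro x ⟨hx, hxc⟩
    obtain ⟨hxH, hfx⟩ := isFInvariant_iff.mp (isFInvariant_invariantCore f) x hx
    refine ⟨hxH, hfx, mem_center_of_forall_commute htf hrange ?_⟩
    rintro _ ⟨h, rfl⟩
    have : h * ⟨x, hxH⟩ = ⟨x, hxH⟩ * h := Subtype.ext (Subgroup.mem_center_iff.mp hxc h)
    exact Commute.map (f := f) this
  exact eq_one_of_pow_eq_one htf hk
    (hf.eq_one_of_mem hinv inf_le_right ⟨hzk, pow_mem hzc k⟩)
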